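/- Let $M$ be a matroid of finite rank, with rank function $r$, on an infinite ground set $E$. Say that $M$ is *fundamental transversal* if there are finitely many sets $A_1,\dots,A_k\subseteq E$ (for some $k\ge 0$) such that - the independent sets of $M$ are exactly the partial transversals of $(A_1,\dots,A_k)$, that is, the sets $I\subseteq E$ for which there is an injection $\phi:I\to\{1,\dots,k\}$ with $x\in A_{\phi(x)}$ for all $x\in I$; and - $A_i\setminus\bigcup_{j\ne i}A_j\neq\emptyset$ for every $i\in\{1,\dots,k\}$. Let $\mathcal Z(M)$ be the lattice, under inclusion, of cyclic flats of $M$, that is, of the flats of $M$ that are (possibly empty) unions of circuits. For a finite set $\mathcal F\subseteq\mathcal Z(M)$ consider the equality $$r\Bigl(\bigcup\mathcal F\Bigr)=\sum_{\emptyset\ne\mathcal F'\subseteq\mathcal F}(-1)^{|\mathcal F'|+1}\,r\Bigl(\bigcap\mathcal F'\Bigr).\qquad(*)$$ Then the following statements are equivalent: 1. $M$ is fundamental transversal; 2. $\mathcal Z(M)$ is finite and $(*)$ holds for all subsets $\mathcal F$ of $\mathcal Z(M)$; 3. $\mathcal Z(M)$ is finite and $(*)$ holds for all ideals $\mathcal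 F$ of $\mathcal Z(M)$, that is, all subsets $\mathcal F\subseteq\mathcal Z(M)$ such that $A\in\mathcal F$ whenever $A\in\mathcal Z(M)$, $B\in\mathcal F$ and $A\subseteq B$; 4. $\mathcal Z(M)$ is finite and $(*)$ holds for all antichains $\mathcal F$ in $\mathcal Z(M)$, that is, all subsets $\mathcal F\subseteq\mathcal Z(M)$ in which no two distinct members are related by inclusion. -/

import Mathlib

namespace Matroid

/-- `I` is a partial transversal of the set system `(A i)`: there is an injection `φ : I → ι` with
`x ∈ A (φ x)` for all `x ∈ I`. -/
def IsPartialTransversal {α ι : Type*} (A : ι → Set α) (I : Set α) : Prop :=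
  ∃ φ : I → ι, Function.Injective φ ∧ ∀ x : I, (x : α) ∈ A (φ x)

/-- The set system `(A i)` of subsets of the ground set is a presentation of `M`: the independent
sets of `M` are exactly the partial transversals. -/
structure IsTransversalPresentation {α ι : Type*} (M : Matroid α) (A : ι → Set α) : Prop where
  subset_ground : ∀ i, A i ⊆ M.E
  indep_iff : ∀ I : Set α, M.Indep I ↔ IsPartialTransversal A I

/-- A fundamental transversal matroid: it has a presentation by finitely many sets
`A_1, …, A_r` none of which is contained in the union of the others. -/
def IsFundamentalTransversal {α : Type*} (M : Matroid α) : Prop :=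
  ∃ (r : ℕ) (A : Fin r → Set α), M.IsTransversalPresentation A ∧
    ∀ i : Fin r, (A i \ ⋃ j ∈ {j : Fin r | j ≠ i}, A j).Nonempty

/-- The (inclusion-ordered) set of cyclic flats: the flats that are (possibly empty) unions of
circuits. -/
def cyclicFlats {α : Type*} (M : Matroid α) : Set (Set α) :=
  {F | M.IsFlat F ∧ ∃ 𝒞 : Set (Set α), (∀ C ∈ 𝒞, M.IsCircuit C) ∧ F = ⋃₀ 𝒞}

/-- The rank of a set as an integer. It is only used for matroids of finite rank. -/
noncomputable def intRk {α : Type*} (M : Matroid α) (X : Set α) : ℤ :=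
  ((M.eRk X).toNat : ℤ)

/-- The equality `r(⋃ 𝓕) = ∑ (-1)^(|𝓕'| + 1) r(⋂ 𝓕')`, where the sum is over the nonempty
subsets `𝓕'` of `𝓕`. -/
def DualInclusionExclusion {α : Type*} (M : Matroid α) (𝓕 : Finset (Set α)) : Prop :=
  M.intRk (⋃₀ (𝓕 : Set (Set α))) =
    ∑ 𝓕' ∈ 𝓕.powerset with 𝓕'.Nonempty,
      (-1 : ℤ) ^ (𝓕'.card + 1) * M.intRk (⋂₀ (𝓕' : Set (Set α)))

/-- `𝓕` is an ideal (down-set) of the set of cyclic flats. -/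
def IsCyclicFlatIdeal {α : Type*} (M : Matroid α) (𝓕 : Set (Set α)) : Prop :=
  𝓕 ⊆ M.cyclicFlats ∧ ∀ B ∈ 𝓕, ∀ A ∈ M.cyclicFlats, A ⊆ B → A ∈ 𝓕

end Matroid

/-! Everything passes through a fundamental base: a base B such that F ∩ B spans F for every cyclic
flat F. Given such a B, ranks of unions and of nonempty intersections of cyclic flats count elements
of B, so (*) is ordinary inclusion–exclusion; each cyclic flat is the closure of a subset of the
finite set B, so there are finitely many.

Fundamental bases correspond to fundamental presentations. Private elements of the sets form such a
base (`exists_isFundamentalBase`, by Hall's theorem); conversely, the complements of the closures of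
the sets B \ {b} present M (`isFundamentalTransversal`).

To build B from (*), Möbius inversion gives weights β on the cyclic flats such that the weights
above X sum to r(M) - r(X). By (*), the rank of any intersection is then a sum of weights
(`exists_isRankWeight`). Each β(Y) is a rank drop, hence nonnegative, and can be realised by β(Y)
elements outside Y lying in every cyclic flat not contained in Y. The union of these sets is B.

Ideals and antichains suffice because adding to a family a subset of one of its members does not
affect (*). -/

namespace Finset

/-! ### Inclusion–exclusion sums over finite sets -/

variable {ι κ : Type*}

/-- The inclusion–exclusion sum of `f` over the nonempty subsets of `S`. -/
def inclusionExclusionSum (f : Finset ι → ℤ) (S : Finset ι) : ℤ :=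
  ∑ T ∈ S.powerset with T.Nonempty, (-1 : ℤ) ^ (T.card + 1) * f T

lemma inclusionExclusionSum_eq_sub (f : Finset ι → ℤ) (S : Finset ι) :
    inclusionExclusionSum f S = f ∅ - ∑ T ∈ S.powerset, (-1 : ℤ) ^ T.card * f T := by
  classical
  have h := sum_filter_add_sum_filter_not S.powerset (fun T => T.Nonempty)
    (fun T => (-1 : ℤ) ^ T.card * f T)
  have h2 : S.powerset.filter (fun T => ¬ T.Nonempty) = {∅} := by
    ext T
    simp only [mem_filter, mem_powerset, not_nonempty_iff_eq_empty, mem_singleton]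
    exact ⟨fun h => h.2, fun h => ⟨h ▸ empty_subset S, h⟩⟩
  rw [h2, sum_singleton] at h
  rw [inclusionExclusionSum, ← h]
  simp only [pow_succ, mul_neg, mul_one, neg_mul, sum_neg_distrib, card_empty, pow_zero, one_mul]
  ring

lemma inclusionExclusionSum_congr {f g : Finset ι → ℤ} {S : Finset ι}
    (h : ∀ T ⊆ S, T.Nonempty → f T = g T) :
    inclusionExclusionSum f S = inclusionExclusionSum g S := by
  refine sum_congr rfl fun T hT => ?_
  rw [mem_filter, mem_powerset] at hT
  rw [h T hT.1 hT.2]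

/-- Among the sets containing a, the terms with and without b cancel in pairs. -/
lemma inclusionExclusionSum_insert [DecidableEq ι] {f : Finset ι → ℤ} {S : Finset ι} {a b : ι}
    (ha : a ∉ S) (hb : b ∈ S) (h : ∀ T, f (insert a (insert b T)) = f (insert a T)) :
    inclusionExclusionSum f (insert a S) = inclusionExclusionSum f S := by
  rw [inclusionExclusionSum_eq_sub, inclusionExclusionSum_eq_sub, sum_powerset_insert ha]
  suffices h0 : ∑ T ∈ S.powerset, (-1 : ℤ) ^ (insert a T).card * f (insert a T) = 0 by
    rw [h0, add_zero]
  obtain ⟨S', hbS', rfl⟩ : ∃ S', b ∉ S' ∧ insert b S' = S :=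
    ⟨S.erase b, notMem_erase b S, insert_erase hb⟩
  rw [sum_powerset_insert hbS', ← sum_add_distrib]
  refine sum_eq_zero fun T hT => ?_
  rw [mem_powerset] at hT
  have hbT : b ∉ T := fun h' => hbS' (hT h')
  have haT : a ∉ insert b T := fun h' => ha (insert_subset_insert b hT h')
  rw [h, card_insert_of_notMem haT, card_insert_of_notMem hbT,
    card_insert_of_notMem (fun h' => haT (mem_insert_of_mem h'))]
  ring

-- Weighted inclusion–exclusion: for each w, expand the product over t ∈ S of 1 - [p t w], which is
-- 1 exactly when no p t w holds.
open Classical in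
lemma inclusionExclusionSum_sum_filter (Ω : Finset κ) (c : κ → ℤ) (p : ι → κ → Prop)
    (S : Finset ι) :
    inclusionExclusionSum (fun T => ∑ w ∈ Ω with ∀ t ∈ T, p t w, c w) S =
      ∑ w ∈ Ω with ∃ t ∈ S, p t w, c w := by
  rw [inclusionExclusionSum_eq_sub]
  have h1 : ∑ T ∈ S.powerset, (-1 : ℤ) ^ T.card * ∑ w ∈ Ω with ∀ t ∈ T, p t w, c w =
      ∑ w ∈ Ω with ¬ ∃ t ∈ S, p t w, c w := by
    simp_rw [sum_filter, mul_sum]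
    rw [sum_comm]
    refine sum_congr rfl fun w _ => ?_
    have h2 := prod_one_add (f := fun t => if p t w then (-1 : ℤ) else 0) S
    have h3 : ∀ T ∈ S.powerset, (-1 : ℤ) ^ T.card * (if ∀ t ∈ T, p t w then c w else 0) =
        c w * ∏ t ∈ T, (if p t w then (-1 : ℤ) else 0) := by
      intro T _
      by_cases hT : ∀ t ∈ T, p t w
      · rw [if_pos hT, prod_congr rfl (g := fun _ => (-1 : ℤ)) (fun t ht => if_pos (hT t ht)),
          prod_const, mul_comm]
      · rw [if_neg hT]
        push Not at hT
        obtain ⟨t, ht, hp⟩ := hT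
        rw [prod_eq_zero ht (if_neg hp), mul_zero, mul_zero]
    rw [sum_congr rfl h3, ← mul_sum, ← h2]
    by_cases hS : ∃ t ∈ S, p t w
    · rw [if_neg (not_not.2 hS)]
      obtain ⟨t, ht, hp⟩ := hS
      rw [prod_eq_zero ht (by simp [hp]), mul_zero]
    · rw [if_pos hS]
      push Not at hS
      rw [prod_eq_one (fun t ht => by simp [hS t ht]), mul_one]
  rw [h1]
  have h4 := sum_filter_add_sum_filter_not Ω (fun w => ∃ t ∈ S, p t w) c
  simp only [notMem_empty, false_imp_iff, implies_true, filter_true]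
  rw [← h4]
  ring

/-- The system is triangular: the sum over S involves f S with coefficient ±1 and otherwise only
proper subsets of S. -/
lemma eq_of_inclusionExclusionSum_eq {f g : Finset ι → ℤ} {Z : Finset ι}
    (h : ∀ S ⊆ Z, inclusionExclusionSum f S = inclusionExclusionSum g S) :
    ∀ S ⊆ Z, S.Nonempty → f S = g S := by
  classical
  intro S
  induction S using Finset.strongInduction with
  | H S ih =>
    intro hSZ hS
    have hS' := h S hSZ
    have hmem : S ∈ S.powerset.filter (fun T => T.Nonempty) := by simp [hS]
    rw [inclusionExclusionSum, inclusionExclusionSum, ← add_sum_erase _ _ hmem,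
      ← add_sum_erase _ _ hmem, sum_congr rfl (g := fun T => (-1 : ℤ) ^ (T.card + 1) * g T)]
      at hS'
    · exact mul_left_cancel₀ (pow_ne_zero _ (by norm_num)) (add_right_cancel hS')
    · intro T hT
      simp only [mem_erase, mem_filter, mem_powerset] at hT
      rw [ih T (hT.2.1.ssubset_of_ne hT.1) (hT.2.1.trans hSZ) hT.2.2]

-- Möbius inversion, by removing a minimal m: its weight enters no equation but its own, so it can
-- be chosen last.
open Classical in
lemma exists_sum_le_eq [PartialOrder ι] (Z : Finset ι) (h : ι → ℤ) :
    ∃ β : ι → ℤ, ∀ x ∈ Z, ∑ y ∈ Z with x ≤ y, β y = h x := by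
  induction Z using Finset.strongInduction with
  | H Z ih =>
    obtain rfl | hZ := Z.eq_empty_or_nonempty
    · exact ⟨0, by simp⟩
    obtain ⟨m, hm⟩ := Z.exists_minimal hZ
    obtain ⟨β, hβ⟩ := ih (Z.erase m) (erase_ssubset hm.prop)
    have hcongr (s : Finset ι) (hs : m ∉ s) (v : ℤ) :
        ∑ y ∈ s, Function.update β m v y = ∑ y ∈ s, β y :=
      sum_congr rfl fun y hy => Function.update_of_ne (ne_of_mem_of_not_mem hy hs) _ _
    refine ⟨Function.update β m (h m - ∑ y ∈ Z.erase m with m ≤ y, β y), fun x hx => ?_⟩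
    conv_lhs => rw [← insert_erase hm.prop]
    rw [filter_insert]
    by_cases hxm : x = m
    · subst hxm
      rw [if_pos le_rfl, sum_insert (by simp), Function.update_self, hcongr _ (by simp),
        erase_insert (notMem_erase _ _), sub_add_cancel]
    · rw [if_neg (fun hle => hxm (hm.eq_of_le hx hle)), hcongr _ (by simp)]
      exact hβ x (mem_erase.2 ⟨hxm, hx⟩)

end Finset

namespace Matroid

open Set

variable {α : Type*} {M : Matroid α} {B X Y : Set α}

/-! ### Integer rank and cyclic flats -/

lemma coe_toNat_eRk [M.RankFinite] (X : Set α) : ((M.eRk X).toNat : ℕ∞) = M.eRk X :=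
  ENat.natCast_toNat (M.isRkFinite_set X).eRk_lt_top.ne

lemma intRk_mono [M.RankFinite] (h : X ⊆ Y) : M.intRk X ≤ M.intRk Y := by
  have h' := M.eRk_mono h
  rw [← coe_toNat_eRk X, ← coe_toNat_eRk Y, Nat.cast_le] at h'
  exact Int.ofNat_le.2 h'

lemma intRk_closure (X : Set α) : M.intRk (M.closure X) = M.intRk X := by
  rw [intRk, intRk, eRk_closure_eq]

lemma intRk_empty : M.intRk ∅ = 0 := by simp [intRk]

lemma IsBasis.intRk_eq_ncard {I : Set α} (h : M.IsBasis I X) : M.intRk X = I.ncard := by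
  rw [intRk, ← h.encard_eq_eRk, ncard]

lemma dualInclusionExclusion_iff (𝓕 : Finset (Set α)) :
    M.DualInclusionExclusion 𝓕 ↔ M.intRk (⋃₀ (𝓕 : Set (Set α))) =
      Finset.inclusionExclusionSum (fun T => M.intRk (⋂₀ (T : Set (Set α)))) 𝓕 := Iff.rfl

lemma dualInclusionExclusion_insert_iff [DecidableEq (Set α)] {𝓕 : Finset (Set α)} (hY : Y ∈ 𝓕)
    (hXY : X ⊆ Y) :
    M.DualInclusionExclusion (insert X 𝓕) ↔ M.DualInclusionExclusion 𝓕 := by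
  by_cases hX : X ∈ 𝓕
  · rw [Finset.insert_eq_of_mem hX]
  rw [dualInclusionExclusion_iff, dualInclusionExclusion_iff,
    Finset.inclusionExclusionSum_insert hX hY]
  · rw [Finset.coe_insert, sUnion_insert,
      union_eq_self_of_subset_left (hXY.trans (subset_sUnion_of_mem (Finset.mem_coe.2 hY)))]
  · intro T
    simp only [Finset.coe_insert, sInter_insert]
    rw [← inter_assoc, inter_eq_self_of_subset_left hXY]

/-- A point added by the closure lies on a circuit contained in the closure. -/
lemma closure_sUnion_mem_cyclicFlats {𝒞 : Set (Set α)} (h𝒞 : ∀ C ∈ 𝒞, M.IsCircuit C) :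
    M.closure (⋃₀ 𝒞) ∈ M.cyclicFlats := by
  refine ⟨M.isFlat_closure _, {C | M.IsCircuit C ∧ C ⊆ M.closure (⋃₀ 𝒞)}, fun C hC => hC.1, ?_⟩
  refine subset_antisymm (fun x hx => ?_) (sUnion_subset fun C hC => hC.2)
  have hsub : ⋃₀ 𝒞 ⊆ M.closure (⋃₀ 𝒞) :=
    M.subset_closure _ (sUnion_subset fun C hC => (h𝒞 C hC).subset_ground)
  by_cases hx' : x ∈ ⋃₀ 𝒞
  · obtain ⟨C, hC, hxC⟩ := hx'
    exact ⟨C, ⟨h𝒞 C hC, (subset_sUnion_of_mem hC).trans hsub⟩, hxC⟩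
  · obtain ⟨C, hCs, hC, hxC⟩ := exists_isCircuit_of_mem_closure hx hx'
    exact ⟨C, ⟨hC, hCs.trans (insert_subset hx hsub)⟩, hxC⟩

lemma IsCircuit.closure_mem_cyclicFlats {C : Set α} (hC : M.IsCircuit C) :
    M.closure C ∈ M.cyclicFlats := by
  simpa using closure_sUnion_mem_cyclicFlats (M := M) (𝒞 := {C}) (by simpa using hC)

lemma closure_empty_mem_cyclicFlats : M.closure ∅ ∈ M.cyclicFlats := by
  simpa using closure_sUnion_mem_cyclicFlats (M := M) (𝒞 := ∅) (by simp)

lemma closure_sUnion_mem_cyclicFlats_of_subset {𝓕 : Set (Set α)} (h𝓕 : 𝓕 ⊆ M.cyclicFlats) :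
    M.closure (⋃₀ 𝓕) ∈ M.cyclicFlats := by
  have : ⋃₀ 𝓕 = ⋃₀ {C | M.IsCircuit C ∧ C ⊆ ⋃₀ 𝓕} := by
    refine subset_antisymm (fun x hx => ?_) (sUnion_subset fun C hC => hC.2)
    obtain ⟨F, hF, hxF⟩ := hx
    obtain ⟨𝒞, h𝒞, rfl⟩ := (h𝓕 hF).2
    obtain ⟨C, hC, hxC⟩ := hxF
    exact ⟨C, ⟨h𝒞 C hC, (subset_sUnion_of_mem hC).trans (subset_sUnion_of_mem hF)⟩, hxC⟩
  rw [this]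
  exact closure_sUnion_mem_cyclicFlats fun C hC => hC.1

/-! ### Fundamental bases -/

/-- A base is fundamental if it contains a spanning set of each cyclic flat. -/
structure IsFundamentalBase (M : Matroid α) (B : Set α) : Prop where
  isBase : M.IsBase B
  subset_closure_inter : ∀ F ∈ M.cyclicFlats, F ⊆ M.closure (F ∩ B)

namespace IsFundamentalBase

lemma inter_isBasis (hB : M.IsFundamentalBase B) {F : Set α} (hF : F ∈ M.cyclicFlats) :
    M.IsBasis (F ∩ B) F :=
  (hB.isBase.indep.subset inter_subset_right).isBasis_of_subset_of_subset_closure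
    inter_subset_left (hB.subset_closure_inter F hF)

lemma finite_cyclicFlats [M.RankFinite] (hB : M.IsFundamentalBase B) : M.cyclicFlats.Finite := by
  refine (hB.isBase.finite.finite_subsets.image M.closure).subset fun F hF => ?_
  refine ⟨F ∩ B, inter_subset_right, ?_⟩
  rw [(hB.inter_isBasis hF).closure_eq_closure, hF.1.closure]

lemma dualInclusionExclusion [M.RankFinite] (hB : M.IsFundamentalBase B) {𝓕 : Finset (Set α)}
    (h𝓕 : (𝓕 : Set (Set α)) ⊆ M.cyclicFlats) : M.DualInclusionExclusion 𝓕 := by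
  classical
  have hfin := hB.isBase.finite
  have hrk {X : Set α} (hX : M.IsBasis (X ∩ B) X) :
      M.intRk X = ∑ b ∈ hfin.toFinset with b ∈ X, (1 : ℤ) := by
    rw [hX.intRk_eq_ncard, Finset.sum_const, nsmul_one,
      ← ncard_coe_finset, Finset.coe_filter]
    congr 2
    ext b
    simp [and_comm]
  -- B meets the union in a basis because it already spans each member; for intersections, `hinter`
  -- needs that all the bases F ∩ B lie in one independent set.
  have hunion : M.IsBasis (⋃₀ (𝓕 : Set (Set α)) ∩ B) (⋃₀ (𝓕 : Set (Set α))) := by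
    refine (hB.isBase.indep.subset inter_subset_right).isBasis_of_subset_of_subset_closure
      inter_subset_left (sUnion_subset fun F hF => ?_)
    exact (hB.subset_closure_inter F (h𝓕 hF)).trans
      (M.closure_subset_closure (inter_subset_inter_left B (subset_sUnion_of_mem hF)))
  have hinter : ∀ T ⊆ 𝓕, T.Nonempty → M.intRk (⋂₀ (T : Set (Set α))) =
      ∑ b ∈ hfin.toFinset with ∀ X ∈ T, b ∈ X, (1 : ℤ) := by
    intro T hT hTne
    rw [hrk]
    · simp only [mem_sInter, Finset.mem_coe]
    · exact hB.isBase.indep.inter_isBasis_sInter (by simpa using hTne)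
        fun X hX => hB.inter_isBasis (h𝓕 (hT hX))
  rw [dualInclusionExclusion_iff, Finset.inclusionExclusionSum_congr hinter,
    Finset.inclusionExclusionSum_sum_filter, hrk hunion]
  simp only [mem_sUnion, Finset.mem_coe]

lemma isFundamentalTransversal [M.RankFinite] (hB : M.IsFundamentalBase B) :
    M.IsFundamentalTransversal := by
  classical
  have : Finite B := hB.isBase.finite
  obtain ⟨r, ⟨e'⟩⟩ := Finite.exists_equiv_fin B
  set e : Fin r → α := fun i => e'.symm i with he
  have heB (i) : e i ∈ B := (e'.symm i).2
  have hsurj : ∀ b ∈ B, ∃ i, e i = b := fun b hb => ⟨e' ⟨b, hb⟩, by simp [he]⟩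
  have hinj : Function.Injective e := Subtype.val_injective.comp e'.symm.injective
  -- The presenting sets are the complements of the hyperplanes spanned by B minus one element; e i
  -- is private to the i-th.
  refine ⟨r, fun i => M.E \ M.closure (B \ {e i}), ⟨fun i => sdiff_subset, fun I => ⟨fun hI => ?_, ?_⟩⟩,
    fun i => ⟨e i, ⟨hB.isBase.subset_ground (heB i),
      hB.isBase.indep.notMem_closure_sdiff_of_mem (heB i)⟩, ?_⟩⟩
  · have hIfin : Fintype I := hI.finite.fintype
    obtain ⟨f, hf, hfm⟩ := (Finset.all_card_le_biUnion_card_iff_exists_injective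
      (fun x : I => Finset.univ.filter fun i => (x : α) ∉ M.closure (B \ {e i}))).1 (by
        intro s
        set N := s.biUnion
          (fun x : I => Finset.univ.filter fun i => (x : α) ∉ M.closure (B \ {e i})) with hN
        have hsub : (Subtype.val '' (s : Set I)) ⊆ M.closure (e '' (N : Set (Fin r))) := by
          rintro _ ⟨x, hx, rfl⟩
          -- Closure commutes with intersections of nonempty families of subsets of B. Inserting B
          -- keeps the family nonempty when N contains every index.
          set 𝓙 : Set (Set α) := insert B ((fun i => B \ {e i}) '' {i | i ∉ N}) with h𝓙
          have h𝓙s : ⋂₀ 𝓙 ⊆ e '' (N : Set (Fin r)) := by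
            intro b hb
            obtain ⟨i, rfl⟩ := hsurj b (hb B (mem_insert _ _))
            refine mem_image_of_mem e (by_contra fun hi => ?_)
            exact (hb _ (mem_insert_of_mem _ ⟨i, hi, rfl⟩)).2 rfl
          refine M.closure_subset_closure h𝓙s ?_
          rw [hB.isBase.indep.closure_sInter_eq_biInter_closure_of_forall_subset
            (insert_nonempty _ _)]
          · simp only [mem_iInter]
            rintro J (rfl | ⟨i, hi, rfl⟩)
            · rw [hB.isBase.closure_eq]
              exact hI.subset_ground x.2
            · by_contra hx'
              exact hi (Finset.mem_biUnion.2 ⟨x, hx, by simpa using hx'⟩)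
          · rintro J (rfl | ⟨i, hi, rfl⟩)
            · exact subset_rfl
            · exact sdiff_subset
        have h1 := (hI.subset (Subtype.coe_image_subset I (s : Set I))).encard_le_eRk_of_subset hsub
        rw [eRk_closure_eq, Subtype.val_injective.encard_image] at h1
        have h2 := h1.trans ((M.eRk_le_encard _).trans (encard_image_le _ _))
        simpa using h2)
    refine ⟨f, hf, fun x => ⟨hI.subset_ground x.2, ?_⟩⟩
    simpa using hfm x
  · rintro ⟨φ, hφ, hφA⟩
    rw [indep_iff_forall_subset_not_isCircuit (fun x hx => (hφA ⟨x, hx⟩).1)]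
    intro D hDI hD
    have hF := hD.closure_mem_cyclicFlats
    -- If the base element matched to x were outside cl D, then cl D, spanned by its part of B,
    -- would lie in the hyperplane that x avoids. Hence |D| ≤ |cl D ∩ B| = r(D), impossible for a
    -- circuit.
    have hmem (x : D) : e (φ ⟨x, hDI x.2⟩) ∈ M.closure D ∩ B := by
      by_contra hx
      refine (hφA ⟨x, hDI x.2⟩).2 ?_
      refine M.closure_subset_closure (subset_sdiff_singleton inter_subset_right hx) ?_
      exact hB.subset_closure_inter _ hF (M.subset_closure D hD.subset_ground x.2)
    have hle : D.encard ≤ (M.closure D ∩ B).encard :=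
      Function.Embedding.encard_le ⟨fun x : D => ⟨_, hmem x⟩, fun x y hxy => by
        have h1 : e (φ ⟨x, hDI x.2⟩) = e (φ ⟨y, hDI y.2⟩) :=
          congrArg (fun z : (M.closure D ∩ B : Set α) => (z : α)) hxy
        exact Subtype.ext (congrArg (fun z : I => (z : α)) (hφ (hinj h1)))⟩
    rw [(hB.inter_isBasis hF).encard_eq_eRk, eRk_closure_eq, ← hD.eRk_add_one_eq] at hle
    rw [← coe_toNat_eRk] at hle
    exact absurd hle (by exact_mod_cast Nat.not_succ_le_self _)
  · simp only [mem_ofPred_eq, mem_iUnion, not_exists]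
    intro j hji hej
    refine hej.2 (M.mem_closure_of_mem' ⟨heB i, fun h => hji (hinj h).symm⟩
      (hB.isBase.subset_ground (heB i)))

end IsFundamentalBase

/-- The base consists of one private element per set. If N indexes the sets that meet a circuit C,
then |N| ≤ r(C), while C together with the private elements of N has rank at most |N|. So these
elements lie in cl C and span C. -/
lemma IsFundamentalTransversal.exists_isFundamentalBase [M.RankFinite]
    (h : M.IsFundamentalTransversal) : ∃ B, M.IsFundamentalBase B := by
  classical
  obtain ⟨r, A, hA, hne⟩ := h
  choose b hbA hb' using hne
  have hb {i j : Fin r} (hij : b i ∈ A j) : j = i := by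
    by_contra hne
    exact hb' i (mem_biUnion (show j ∈ {j : Fin r | j ≠ i} from hne) hij)
  have hinj : Function.Injective b := fun i j hij => hb (hij ▸ hbA i : b j ∈ A i)
  have hindep : M.Indep (range b) := by
    rw [hA.indep_iff]
    refine ⟨fun x => x.2.choose, fun x y hxy => ?_, fun x => ?_⟩
    · exact Subtype.ext (x.2.choose_spec.symm.trans ((congrArg b hxy).trans y.2.choose_spec))
    · have := hbA x.2.choose
      rwa [x.2.choose_spec] at this
  have hbase : M.IsBase (range b) := by
    refine hindep.isBase_of_eRk_ge (finite_range b) ?_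
    obtain ⟨B, hB⟩ := M.exists_isBase
    obtain ⟨φ, hφ, -⟩ := (hA.indep_iff B).1 hB.indep
    rw [← hB.encard_eq_eRank, hindep.eRk_eq_encard, ← image_univ, hinj.encard_image]
    exact Function.Embedding.encard_le
      ((⟨φ, hφ⟩ : B ↪ Fin r).trans (Equiv.Set.univ (Fin r)).symm.toEmbedding)
  refine ⟨range b, hbase, ?_⟩
  rintro F ⟨hF, 𝒞, h𝒞, hF𝒞⟩ x hx
  obtain ⟨C, hC, hxC⟩ : x ∈ ⋃₀ 𝒞 := hF𝒞 ▸ hx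
  have hCF : C ⊆ F := hF𝒞 ▸ subset_sUnion_of_mem hC
  replace hC := h𝒞 C hC
  have hCfin : Fintype C := hC.finite.fintype
  set N : Finset (Fin r) := Finset.univ.filter fun i => ∃ x ∈ C, x ∈ A i with hN
  have hcard : (N.card : ℕ∞) ≤ M.eRk C := by
    set t : C → Finset (Fin r) := fun x => Finset.univ.filter fun i => (x : α) ∈ A i with ht
    -- Hall's condition fails on C but holds on each C \ {y}, so the only violating subset is C
    -- itself.
    have hnot : ¬ ∀ s : Finset C, s.card ≤ (s.biUnion t).card := by
      rw [Finset.all_card_le_biUnion_card_iff_exists_injective]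
      rintro ⟨f, hf, hft⟩
      exact hC.not_indep ((hA.indep_iff C).2 ⟨f, hf, fun x => by simpa [ht] using hft x⟩)
    push Not at hnot
    obtain ⟨s, hs⟩ := hnot
    have hsuniv : s = Finset.univ := by
      by_contra hsne
      obtain ⟨y, hy⟩ : ∃ y, y ∉ s := by
        by_contra! hall
        exact hsne (Finset.eq_univ_iff_forall.2 hall)
      obtain ⟨φ, hφ, hφA⟩ := (hA.indep_iff _).1 (hC.sdiff_singleton_indep y.2)
      have hys (z : C) (hz : z ∈ s) : (z : α) ∈ C \ {(y : α)} :=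
        ⟨z.2, fun h => hy (Subtype.ext h ▸ hz)⟩
      refine hs.not_ge ?_
      have himg : (s.attach.image fun z : {z // z ∈ s} => φ ⟨z.1, hys z.1 z.2⟩) ⊆ s.biUnion t := by
        intro i hi
        obtain ⟨z, -, rfl⟩ := Finset.mem_image.1 hi
        exact Finset.mem_biUnion.2 ⟨z.1, z.2, by simpa [ht] using hφA ⟨z.1, hys z.1 z.2⟩⟩
      refine le_trans (le_of_eq ?_) (Finset.card_le_card himg)
      rw [Finset.card_image_of_injective, Finset.card_attach]
      intro z w hzw
      exact Subtype.ext (Subtype.ext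
        (congrArg (fun v : (C \ {(y : α)} : Set α) => (v : α)) (hφ hzw)))
    have hNt : N = s.biUnion t := by
      ext i
      simp [hN, ht, hsuniv]
    have h1 : N.card + 1 ≤ Fintype.card C := by
      rw [hNt, ← Finset.card_univ, ← hsuniv]
      exact hs
    have h2 : ((N.card + 1 : ℕ) : ℕ∞) ≤ C.encard := by
      rw [encard_eq_coe_toFinset_card, toFinset_card]
      exact_mod_cast h1
    rw [← hC.eRk_add_one_eq, ← coe_toNat_eRk] at h2
    rw [← coe_toNat_eRk]
    exact Nat.cast_le.2 (Nat.le_of_succ_le_succ (by exact_mod_cast h2))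
  have hle : M.eRk (C ∪ b '' N) ≤ N.card := by
    rw [eRk_le_iff]
    intro J hJ hJi
    obtain ⟨φ, hφ, hφA⟩ := (hA.indep_iff J).1 hJi
    have hφN (x : J) : φ x ∈ N := by
      obtain hx | ⟨i, hi, hix⟩ := hJ x.2
      · simpa [hN] using ⟨x, hx, hφA x⟩
      · have := hφA x
        rw [← hix] at this
        exact hb this ▸ hi
    rw [← encard_coe_eq_coe_finsetCard]
    exact Function.Embedding.encard_le ⟨fun x : J => ⟨φ x, hφN x⟩,
      fun x y hxy => hφ (congrArg Subtype.val hxy)⟩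
  have hbN : M.IsBasis (b '' N) (C ∪ b '' N) := by
    have hi := hindep.subset (image_subset_range b N)
    refine hi.isBasis_of_eRk_ge ((finite_range b).subset (image_subset_range b N))
      subset_union_right ?_ (union_subset hC.subset_ground hi.subset_ground)
    rwa [hi.eRk_eq_encard, hinj.encard_image, encard_coe_eq_coe_finsetCard]
  have hbF : b '' N ⊆ F := by
    have := (M.isRkFinite_set C).closure_eq_closure_of_subset_of_eRk_ge_eRk
      (subset_union_left (t := b '' N)) (hle.trans hcard)
    rw [← hF.closure]
    refine subset_trans ?_ (M.closure_subset_closure hCF)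
    rw [this]
    exact subset_union_right.trans (M.subset_closure _ hbN.subset_ground)
  exact M.closure_subset_closure (subset_inter hbF (image_subset_range b N))
    (hbN.subset_closure (Or.inl hxC))

end Matroid

/-! ### Rank weights: constructing a fundamental base from (*) -/

namespace Matroid

open Set

variable {α : Type*} {M : Matroid α} {X Y : Set α}

open Classical in
/-- A weight on the finite family `Z` expresses the ranks of its intersections if the rank of each
intersection of members of `Z` is the total weight of the `Y ∈ Z` that contain none of them. -/
def IsRankWeight (M : Matroid α) (Z : Finset (Set α)) (β : Set α → ℤ) : Prop :=
  ∀ S ⊆ Z, M.intRk (M.E ∩ ⋂₀ (S : Set (Set α))) = ∑ Y ∈ Z with ∀ X ∈ S, ¬ X ⊆ Y, β Y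

lemma exists_isRankWeight {Z : Finset (Set α)}
    (hZ : (Z : Set (Set α)) = M.cyclicFlats) (h : ∀ S ⊆ Z, M.DualInclusionExclusion S) :
    ∃ β, M.IsRankWeight Z β := by
  classical
  have hmem {F : Set α} : F ∈ Z ↔ F ∈ M.cyclicFlats := by rw [← hZ, Finset.mem_coe]
  obtain ⟨β, hβ⟩ := Z.exists_sum_le_eq (fun X => M.intRk M.E - M.intRk X)
  have htot : ∑ Y ∈ Z, β Y = M.intRk M.E := by
    -- The closure of ∅ is the least cyclic flat and has rank 0, so its equation gives the total
    -- weight.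
    have := hβ _ (hmem.2 closure_empty_mem_cyclicFlats)
    rw [intRk_closure, intRk_empty, sub_zero, Finset.filter_true_of_mem] at this
    · exact this
    · intro Y hY
      have hY' := (hmem.1 hY).1
      exact (M.closure_subset_closure (empty_subset Y)).trans hY'.closure.subset
  refine ⟨β, fun S hS => ?_⟩
  obtain rfl | hSne := S.eq_empty_or_nonempty
  · simp [htot]
  have hSE : ⋂₀ (S : Set (Set α)) ⊆ M.E := by
    obtain ⟨F, hF⟩ := hSne
    exact (sInter_subset_of_mem (Finset.mem_coe.2 hF)).trans (hmem.1 (hS hF)).1.subset_ground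
  rw [inter_eq_self_of_subset_right hSE]
  refine Finset.eq_of_inclusionExclusionSum_eq
    (f := fun S => M.intRk (⋂₀ (S : Set (Set α))))
    (g := fun S => ∑ Y ∈ Z with ∀ X ∈ S, ¬ X ⊆ Y, β Y) (fun S hS => ?_) S hS hSne
  rw [← (dualInclusionExclusion_iff S).1 (h S hS)]
  trans ∑ Y ∈ Z with ∃ X ∈ S, ¬ X ⊆ Y, β Y
  swap
  · convert! (Finset.inclusionExclusionSum_sum_filter Z β (fun X Y => ¬ X ⊆ Y) S).symm
  have hS' : (S : Set (Set α)) ⊆ M.cyclicFlats := fun F hF => hmem.1 (hS hF)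
  have hJ := hβ _ (hmem.2 (closure_sUnion_mem_cyclicFlats_of_subset hS'))
  -- The flats above the join of S are those containing every member of S, so the remaining flats
  -- carry total weight r(⋃ S).
  have hJ' : Z.filter (fun Y => M.closure (⋃₀ (S : Set (Set α))) ≤ Y) =
      Z.filter (fun Y => ¬ ∃ X ∈ S, ¬ X ⊆ Y) := by
    refine Finset.filter_congr fun Y hY => ?_
    have hYc := (hmem.1 hY).1.closure
    push Not
    refine ⟨fun hle X hX => ?_, fun hle => ?_⟩
    · refine subset_trans ?_ hle
      exact (subset_sUnion_of_mem (Finset.mem_coe.2 hX)).trans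
        (M.subset_closure _ (sUnion_subset fun F hF => (hS' hF).1.subset_ground))
    · exact (M.closure_subset_closure (sUnion_subset hle)).trans hYc.subset
  rw [hJ', intRk_closure] at hJ
  have hsplit := Finset.sum_filter_add_sum_filter_not Z (fun Y => ∃ X ∈ S, ¬ X ⊆ Y) β
  linarith

/-- The intersection of the members of `Z` not contained in `Y`. -/
def interNotLE (M : Matroid α) (Z : Finset (Set α)) (Y : Set α) : Set α :=
  M.E ∩ ⋂₀ {F | F ∈ Z ∧ ¬ F ⊆ Y}

lemma interNotLE_subset {Z : Finset (Set α)} {F : Set α} (hF : F ∈ Z) (hFY : ¬ F ⊆ Y) :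
    M.interNotLE Z Y ⊆ F :=
  inter_subset_right.trans (sInter_subset_of_mem ⟨hF, hFY⟩)

namespace IsRankWeight

variable {Z : Finset (Set α)} {β : Set α → ℤ}

/-- Adding Y to the family of all F not contained in Y removes exactly the summand β Y: a flat
containing no such F is itself contained in Y, and contains Y only if it equals Y. -/
lemma intRk_interNotLE (h : M.IsRankWeight Z β) (hY : Y ∈ Z) :
    M.intRk (M.interNotLE Z Y) = M.intRk (M.interNotLE Z Y ∩ Y) + β Y := by
  classical
  have h1 := h (Z.filter fun F => ¬ F ⊆ Y) (Finset.filter_subset _ _)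
  have h2 := h (insert Y (Z.filter fun F => ¬ F ⊆ Y))
    (Finset.insert_subset hY (Finset.filter_subset _ _))
  have hE1 : M.E ∩ ⋂₀ ((Z.filter fun F => ¬ F ⊆ Y : Finset (Set α)) : Set (Set α)) =
      M.interNotLE Z Y := by
    rw [interNotLE, Finset.coe_filter]
  have hE2 : M.E ∩ ⋂₀ ((insert Y (Z.filter fun F => ¬ F ⊆ Y) : Finset (Set α)) : Set (Set α)) =
      M.interNotLE Z Y ∩ Y := by
    rw [Finset.coe_insert, sInter_insert, ← hE1, inter_assoc, inter_comm Y]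
  have hF : Z.filter (fun Y' => ∀ X ∈ Z.filter (fun F => ¬ F ⊆ Y), ¬ X ⊆ Y') =
      insert Y (Z.filter fun Y' => ∀ X ∈ insert Y (Z.filter fun F => ¬ F ⊆ Y), ¬ X ⊆ Y') := by
    ext Y'
    simp only [Finset.mem_insert, Finset.mem_filter]
    constructor
    · rintro ⟨hY'Z, hY'⟩
      have hle : Y' ⊆ Y := by_contra fun hn => hY' Y' ⟨hY'Z, hn⟩ subset_rfl
      by_cases heq : Y' = Y
      · exact Or.inl heq
      · refine Or.inr ⟨hY'Z, ?_⟩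
        rintro X (rfl | hX)
        · exact fun hle' => heq (hle.antisymm hle')
        · exact hY' X hX
    · rintro (rfl | ⟨hY'Z, hY'⟩)
      · exact ⟨hY, fun X hX => hX.2⟩
      · exact ⟨hY'Z, fun X hX => hY' X (Or.inr hX)⟩
  rw [hE1, hF, Finset.sum_insert (by simp)] at h1
  rw [hE2] at h2
  rw [h1, h2, add_comm]

lemma nonneg [M.RankFinite] (h : M.IsRankWeight Z β) (hY : Y ∈ Z) : 0 ≤ β Y := by
  have h1 := h.intRk_interNotLE hY
  have h2 : M.intRk (M.interNotLE Z Y ∩ Y) ≤ M.intRk (M.interNotLE Z Y) :=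
    intRk_mono inter_subset_left
  linarith

/-- By subadditivity, a rank drop of β Y on intersecting with Y forces at least β Y elements outside
Y. -/
lemma exists_finset_subset_interNotLE [M.RankFinite] (h : M.IsRankWeight Z β) (hY : Y ∈ Z) :
    ∃ s : Finset α, (s : Set α) ⊆ M.interNotLE Z Y \ Y ∧ (s.card : ℤ) = β Y := by
  have h1 := h.intRk_interNotLE hY
  obtain ⟨n, hn⟩ := Int.eq_ofNat_of_zero_le (h.nonneg hY)
  have hle : (n : ℕ∞) ≤ (M.interNotLE Z Y \ Y).encard := by
    have h2 := (M.eRk_le_eRk_inter_add_eRk_sdiff (M.interNotLE Z Y) Y).trans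
      (add_le_add_right (M.eRk_le_encard _) _)
    rw [← coe_toNat_eRk, ← coe_toNat_eRk (M.interNotLE Z Y ∩ Y)] at h2
    have h3 : (M.eRk (M.interNotLE Z Y)).toNat = (M.eRk (M.interNotLE Z Y ∩ Y)).toNat + n := by
      rw [hn, intRk, intRk] at h1
      exact_mod_cast h1
    rw [h3, Nat.cast_add] at h2
    exact (ENat.add_le_add_iff_left (ENat.natCast_ne_top _)).1 h2
  obtain ⟨t, ht, htn⟩ := exists_subset_encard_eq hle
  have htf : t.Finite := finite_of_encard_eq_coe htn
  refine ⟨htf.toFinset, by simpa using ht, ?_⟩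
  rw [hn, ← ncard_eq_toFinset_card t htf, ncard, htn]
  rfl

open Classical in
lemma intRk_eq (h : M.IsRankWeight Z β) {F : Set α} (hF : F ∈ Z) (hFE : F ⊆ M.E) :
    M.intRk F = ∑ Y ∈ Z.filter (fun Y => ¬ F ⊆ Y), β Y := by
  classical
  have := h {F} (by simpa using hF)
  simpa [inter_eq_self_of_subset_right hFE] using this

/-- The sum for {F} includes β Y and every summand of the sum for {F, Y}, which omits β Y;
nonnegativity does the rest. -/
lemma intRk_inter_add_le [M.RankFinite] (h : M.IsRankWeight Z β) {F : Set α} (hF : F ∈ Z)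
    (hFE : F ⊆ M.E) (hY : Y ∈ Z) (hFY : ¬ F ⊆ Y) : M.intRk (F ∩ Y) + β Y ≤ M.intRk F := by
  classical
  have h1 := h {F, Y} (by simp [Finset.insert_subset_iff, hF, hY])
  have hE : M.E ∩ ⋂₀ (({F, Y} : Finset (Set α)) : Set (Set α)) = F ∩ Y := by
    rw [Finset.coe_pair, sInter_pair]
    exact inter_eq_self_of_subset_right (inter_subset_left.trans hFE)
  rw [hE] at h1
  rw [h1, h.intRk_eq hF hFE, add_comm, ← Finset.sum_insert (by simp)]
  refine Finset.sum_le_sum_of_subset_of_nonneg ?_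
    fun Y' hY' _ => h.nonneg (Finset.mem_filter.1 hY').1
  refine Finset.insert_subset (Finset.mem_filter.2 ⟨hY, hFY⟩) fun Y' hY' => ?_
  rw [Finset.mem_filter] at hY' ⊢
  exact ⟨hY'.1, hY'.2 F (by simp)⟩

lemma exists_isFundamentalBase [M.RankFinite] (h : M.IsRankWeight Z β)
    (hZ : (Z : Set (Set α)) = M.cyclicFlats) : ∃ B, M.IsFundamentalBase B := by
  classical
  have hmem {F : Set α} : F ∈ Z ↔ F ∈ M.cyclicFlats := by rw [← hZ, Finset.mem_coe]
  have hex : ∀ Y, ∃ s : Finset α, Y ∈ Z →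
      (s : Set α) ⊆ M.interNotLE Z Y \ Y ∧ (s.card : ℤ) = β Y := by
    intro Y
    by_cases hY : Y ∈ Z
    · obtain ⟨s, hs⟩ := h.exists_finset_subset_interNotLE hY
      exact ⟨s, fun _ => hs⟩
    · exact ⟨∅, fun h => absurd h hY⟩
  choose s hs using hex
  have hs_sub {Y F : Set α} (hY : Y ∈ Z) (hF : F ∈ Z) (hFY : ¬ F ⊆ Y) : (s Y : Set α) ⊆ F :=
    (hs Y hY).1.trans (sdiff_subset.trans (interNotLE_subset hF hFY))
  have hs_notMem {Y : Set α} (hY : Y ∈ Z) {x : α} (hx : x ∈ s Y) : x ∉ Y :=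
    ((hs Y hY).1 hx).2
  -- For Y ≠ Y', one is not contained in the other; if Y' ⊄ Y, then s Y ⊆ Y', whereas s Y' avoids
  -- Y'.
  have hdisj : (Z : Set (Set α)).PairwiseDisjoint s := by
    intro Y hY Y' hY' hne
    refine Finset.disjoint_left.2 fun x hx hx' => ?_
    by_cases hle : Y ⊆ Y'
    · have hle' : ¬ Y' ⊆ Y := fun h' => hne (hle.antisymm h')
      exact hs_notMem hY' hx' (hs_sub hY hY' hle' hx)
    · exact hs_notMem hY hx (hs_sub hY' hY hle hx')
  have hcard (Z' : Finset (Set α)) (hZ' : Z' ⊆ Z) :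
      ((Z'.biUnion s).card : ℤ) = ∑ Y ∈ Z', β Y := by
    rw [Finset.card_biUnion (hdisj.subset (Finset.coe_subset.2 hZ')), Nat.cast_sum]
    exact Finset.sum_congr rfl fun Y hY => (hs Y (hZ' hY)).2
  have hground : ((Z.biUnion s : Finset α) : Set α) ⊆ M.E := by
    intro x hx
    obtain ⟨Y, hY, hx⟩ := Finset.mem_biUnion.1 hx
    exact ((hs Y hY).1 hx).1.1
  have hindep : M.Indep (Z.biUnion s : Finset α) := by
    rw [indep_iff_forall_subset_not_isCircuit hground]
    intro D hD hDC
    -- For Y maximal among the flats whose s Y meets the circuit D, the rest of D lies in Y. As D ∩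
    -- Y is independent, |D| ≤ r(cl D ∩ Y) + β Y ≤ r(D), a contradiction.
    obtain ⟨Y, hYmax⟩ := (Z.filter fun Y => (D ∩ s Y).Nonempty).exists_maximal (by
      obtain ⟨x, hx⟩ := hDC.nonempty
      obtain ⟨Y, hY, hxY⟩ := Finset.mem_biUnion.1 (hD hx)
      exact ⟨Y, Finset.mem_filter.2 ⟨hY, x, hx, hxY⟩⟩)
    obtain ⟨hY, x, hxD, hxs⟩ := Finset.mem_filter.1 hYmax.prop
    have hsub : D ⊆ Y ∪ s Y := by
      intro z hz
      obtain ⟨Y', hY', hzY'⟩ := Finset.mem_biUnion.1 (hD hz)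
      by_cases hle : Y ⊆ Y'
      · have := hYmax.eq_of_le (Finset.mem_filter.2 ⟨hY', z, hz, hzY'⟩) hle
        exact Or.inr (this ▸ hzY')
      · exact Or.inl (hs_sub hY' hY hle hzY')
    have hDfin := hDC.finite
    have hDcl := M.subset_closure D hDC.subset_ground
    have hle := h.intRk_inter_add_le (hmem.2 hDC.closure_mem_cyclicFlats)
      (M.closure_subset_ground D) hY (fun hle => hs_notMem hY hxs (hle (hDcl hxD)))
    have hDY : M.Indep (D ∩ Y) := hDC.ssubset_indep
      ⟨inter_subset_left, fun hle => hs_notMem hY hxs (hle hxD).2⟩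
    have h1 : ((D ∩ Y).ncard : ℤ) ≤ M.intRk (M.closure D ∩ Y) := by
      rw [← hDY.isBasis_self.intRk_eq_ncard]
      exact intRk_mono (inter_subset_inter_left Y hDcl)
    have h2 : D.ncard ≤ (D ∩ Y).ncard + (s Y).card := by
      rw [← ncard_coe_finset]
      refine le_trans (ncard_le_ncard ?_ ((hDfin.inter_of_left _).union (s Y).finite_toSet))
        (ncard_union_le _ _)
      exact fun z hz => (hsub hz).imp (fun hzY => ⟨hz, hzY⟩) id
    have h3 : M.intRk D + 1 = D.ncard := by
      have := hDC.eRk_add_one_eq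
      rw [← coe_toNat_eRk, ← hDfin.cast_ncard_eq] at this
      rw [intRk]
      exact_mod_cast this
    rw [intRk_closure, ← (hs Y hY).2] at hle
    omega
  refine ⟨(Z.biUnion s : Finset α), ?_, fun F hF => ?_⟩
  · refine hindep.isBase_of_eRk_ge (Finset.finite_toSet _) ?_
    have h0 : M.intRk M.E = ∑ Y ∈ Z, β Y := by simpa using h ∅ (Finset.empty_subset Z)
    rw [← hcard Z subset_rfl, intRk] at h0
    rw [hindep.eRk_eq_encard, encard_coe_eq_coe_finsetCard, ← eRk_ground, ← coe_toNat_eRk]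
    exact_mod_cast h0.le
  · have hFE := hF.1.subset_ground
    have hI : M.Indep ((Z.filter fun Y => ¬ F ⊆ Y).biUnion s : Finset α) :=
      hindep.subset (Finset.coe_subset.2
        (Finset.biUnion_subset_biUnion_of_subset_left s (Finset.filter_subset _ _)))
    have hIF : (((Z.filter fun Y => ¬ F ⊆ Y).biUnion s : Finset α) : Set α) ⊆ F := by
      intro x hx
      obtain ⟨Y, hY, hx⟩ := Finset.mem_biUnion.1 hx
      rw [Finset.mem_filter] at hY
      exact hs_sub hY.1 (hmem.2 hF) hY.2 hx
    -- The sets s Y with F ⊄ Y lie in F, and their sizes add up to r(F).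
    have hbasis : M.IsBasis ((Z.filter fun Y => ¬ F ⊆ Y).biUnion s : Finset α) F := by
      refine hI.isBasis_of_eRk_ge (Finset.finite_toSet _) hIF ?_ hFE
      have h0 := h.intRk_eq (hmem.2 hF) hFE
      rw [← hcard _ (Finset.filter_subset _ _), intRk] at h0
      rw [hI.eRk_eq_encard, encard_coe_eq_coe_finsetCard, ← coe_toNat_eRk]
      exact_mod_cast h0.le
    refine hbasis.subset_closure.trans (M.closure_subset_closure (subset_inter hIF ?_))
    exact Finset.coe_subset.2
      (Finset.biUnion_subset_biUnion_of_subset_left s (Finset.filter_subset _ _))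

end IsRankWeight

/-! ### Reductions between families of cyclic flats -/

/-- Members properly contained in other members can be discarded one at a time until an antichain
remains. -/
lemma dualInclusionExclusion_of_forall_isAntichain
    (h : ∀ 𝓕 : Finset (Set α), (𝓕 : Set (Set α)) ⊆ M.cyclicFlats →
      IsAntichain (fun X Y : Set α => X ⊆ Y) (𝓕 : Set (Set α)) → M.DualInclusionExclusion 𝓕)
    (𝓕 : Finset (Set α)) (h𝓕 : (𝓕 : Set (Set α)) ⊆ M.cyclicFlats) :
    M.DualInclusionExclusion 𝓕 := by
  classical
  induction 𝓕 using Finset.strongInduction with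
  | H 𝓕 ih =>
    by_cases hanti : IsAntichain (fun X Y : Set α => X ⊆ Y) (𝓕 : Set (Set α))
    · exact h 𝓕 h𝓕 hanti
    obtain ⟨X, hX, Y, hY, hne, hXY⟩ : ∃ X ∈ 𝓕, ∃ Y ∈ 𝓕, X ≠ Y ∧ X ⊆ Y := by
      by_contra! hcon
      exact hanti fun X hX Y hY hne => hcon X hX Y hY hne
    rw [← Finset.insert_erase hX,
      dualInclusionExclusion_insert_iff (Finset.mem_erase.2 ⟨hne.symm, hY⟩) hXY]
    exact ih _ (Finset.erase_ssubset hX)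
      ((Finset.coe_subset.2 (Finset.erase_subset X 𝓕)).trans h𝓕)

/-- Pass to the ideal generated by the family: each cyclic flat added lies below an original member,
so (*) is unchanged. -/
lemma dualInclusionExclusion_of_forall_isCyclicFlatIdeal (hfin : M.cyclicFlats.Finite)
    (h : ∀ 𝓕 : Finset (Set α), M.IsCyclicFlatIdeal (𝓕 : Set (Set α)) →
      M.DualInclusionExclusion 𝓕)
    (𝓕 : Finset (Set α)) (h𝓕 : (𝓕 : Set (Set α)) ⊆ M.cyclicFlats) :
    M.DualInclusionExclusion 𝓕 := by
  classical
  have hunion (𝓖 : Finset (Set α)) (h𝓖 : ∀ X ∈ 𝓖, ∃ Y ∈ 𝓕, X ⊆ Y) :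
      M.DualInclusionExclusion (𝓖 ∪ 𝓕) ↔ M.DualInclusionExclusion 𝓕 := by
    induction 𝓖 using Finset.induction_on with
    | empty => rw [Finset.empty_union]
    | insert X 𝓖 _ ih =>
      obtain ⟨Y, hY, hXY⟩ := h𝓖 X (Finset.mem_insert_self _ _)
      rw [Finset.insert_union,
        dualInclusionExclusion_insert_iff (Finset.mem_union_right _ hY) hXY]
      exact ih fun X' hX' => h𝓖 X' (Finset.mem_insert_of_mem hX')
  set 𝓖 := hfin.toFinset.filter fun X => ∃ Y ∈ 𝓕, X ⊆ Y with h𝓖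
  have hmem {X : Set α} : X ∈ 𝓖 ↔ X ∈ M.cyclicFlats ∧ ∃ Y ∈ 𝓕, X ⊆ Y := by simp [h𝓖]
  have hsub : 𝓕 ⊆ 𝓖 := fun X hX => hmem.2 ⟨h𝓕 hX, X, hX, subset_rfl⟩
  rw [← hunion 𝓖 fun X hX => (hmem.1 hX).2, Finset.union_eq_left.2 hsub]
  refine h 𝓖 ⟨fun X hX => (hmem.1 hX).1, fun X hX X' hX' hle => ?_⟩
  obtain ⟨Y, hY, hXY⟩ := (hmem.1 hX).2
  exact hmem.2 ⟨hX', Y, hY, hle.trans hXY⟩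

end Matroid

theorem theorem5p3 {α : Type*} (M : Matroid α) (hrank : M.RankFinite) (hinf : M.E.Infinite) :
    List.TFAE
      [ M.IsFundamentalTransversal,
        M.cyclicFlats.Finite ∧
          ∀ 𝓕 : Finset (Set α), (𝓕 : Set (Set α)) ⊆ M.cyclicFlats → M.DualInclusionExclusion 𝓕,
        M.cyclicFlats.Finite ∧
          ∀ 𝓕 : Finset (Set α), M.IsCyclicFlatIdeal (𝓕 : Set (Set α)) →
            M.DualInclusionExclusion 𝓕,
        M.cyclicFlats.Finite ∧
          ∀ 𝓕 : Finset (Set α), (𝓕 : Set (Set α)) ⊆ M.cyclicFlats →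
            IsAntichain (fun X Y : Set α => X ⊆ Y) (𝓕 : Set (Set α)) →
            M.DualInclusionExclusion 𝓕 ] := by
  have := hrank
  have hbase : (M.cyclicFlats.Finite ∧ ∀ 𝓕 : Finset (Set α), (𝓕 : Set (Set α)) ⊆ M.cyclicFlats →
      M.DualInclusionExclusion 𝓕) → M.IsFundamentalTransversal := by
    rintro ⟨hfin, h⟩
    obtain ⟨β, hβ⟩ := Matroid.exists_isRankWeight hfin.coe_toFinset
      fun S hS => h S ((Finset.coe_subset.2 hS).trans hfin.coe_toFinset.subset)
    obtain ⟨B, hB⟩ := hβ.exists_isFundamentalBase hfin.coe_toFinset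
    exact hB.isFundamentalTransversal
  tfae_have 1 → 2 := fun h => by
    obtain ⟨B, hB⟩ := h.exists_isFundamentalBase
    exact ⟨hB.finite_cyclicFlats, fun 𝓕 h𝓕 => hB.dualInclusionExclusion h𝓕⟩
  tfae_have 2 → 3 := fun h => ⟨h.1, fun 𝓕 h𝓕 => h.2 𝓕 h𝓕.1⟩
  tfae_have 2 → 4 := fun h => ⟨h.1, fun 𝓕 h𝓕 _ => h.2 𝓕 h𝓕⟩
  tfae_have 3 → 1 := fun h => hbase
    ⟨h.1, Matroid.dualInclusionExclusion_of_forall_isCyclicFlatIdeal h.1 h.2⟩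
  tfae_have 4 → 1 := fun h => hbase
    ⟨h.1, Matroid.dualInclusionExclusion_of_forall_isAntichain h.2⟩
  tfae_finish
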